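/- Theorem. For every integer $k \ge 1$ there are a (non-degenerate) axis-aligned rectangle $P$ and $k$ pairwise disjoint, arbitrarily oriented (non-degenerate) rectangular holes in the interior of $P$ such that guarding $P$ with guards placed only at vertices of the holes requires at least $3k+1$ vertex guards with $180^\circ$ vision. Here the region to be guarded is the closed set $F$ obtained from $P$ by removing the interiors of the holes. A vertex guard stands at a vertex $v$ of a hole and is aligned with that hole: it has a facing direction $d$ that is perpendicular to one of the sides of the hole (so there are four possible facing directions at each vertex, and several guards may stand at the same vertex). It sees a point $x$ if $x$ lies in the closed half-plane $\{x : \langle x - v, d\rangle \ge 0\}$ and the line segment from $v$ to $x$ is contained in $F$. A finite set of vertex guards guards $P$ if every point of $F$ is seen by at least one of them. The claim is that $P$ can be guarded by some finite set of vertex guards, and that every such set has at least $3k+1$ elements. -/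

import Mathlib

/-- The Euclidean plane. -/
abbrev Plane : Type := EuclideanSpace ℝ (Fin 2)

/-- A non-degenerate, arbitrarily oriented rectangle in the plane, given by its center and by two
nonzero orthogonal vectors `p`, `q`, which are half of its sides. -/
structure Rect where
  center : Plane
  p : Plane
  q : Plane
  p_ne_zero : p ≠ 0
  q_ne_zero : q ≠ 0
  orthogonal : inner ℝ p q = 0

namespace Rect

/-- The closed rectangle, with its boundary, as a set of points. -/
def carrier (R : Rect) : Set Plane :=
  {x | ∃ s t : ℝ, |s| ≤ 1 ∧ |t| ≤ 1 ∧ x = R.center + s • R.p + t • R.q}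

/-- The four vertices `center ± p ± q`; a sign is a unit of `ℤ`. -/
def vertex (R : Rect) (σ τ : ℤˣ) : Plane :=
  R.center + ((σ : ℤ) : ℝ) • R.p + ((τ : ℤ) : ℝ) • R.q

/-- A vector parallel to a chosen side: half of the first side or half of the second side. -/
def side (R : Rect) (j : Fin 2) : Plane := ![R.p, R.q] j

end Rect

/-- The closed axis-aligned rectangle with lower left corner `lo` and upper right corner `hi`. -/
def axisRect (lo hi : Plane) : Set Plane := {x | ∀ i, lo i ≤ x i ∧ x i ≤ hi i}

/-- The axis-aligned rectangle spanned by `lo` and `hi` is non-degenerate, and `H` is a family of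
pairwise disjoint rectangular holes in its interior. -/
structure IsRectWithHoles {k : ℕ} (lo hi : Plane) (H : Fin k → Rect) : Prop where
  lo_lt_hi : ∀ i, lo i < hi i
  hole_subset : ∀ i, (H i).carrier ⊆ interior (axisRect lo hi)
  disjoint : Pairwise fun i j => Disjoint (H i).carrier (H j).carrier

/-- The closed polygonal region that remains: the outer rectangle without the interiors of the
holes. -/
def region {k : ℕ} (lo hi : Plane) (H : Fin k → Rect) : Set Plane :=
  axisRect lo hi \ ⋃ i, interior (H i).carrier

/-- A vertex guard with 180° vision among `k` holes: the hole on which it stands, the vertex of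
that hole, and the direction that it faces, which is perpendicular to a side of that hole
(one of the four vectors `± p`, `± q`). -/
structure VertexGuard (k : ℕ) where
  hole : Fin k
  σ : ℤˣ
  τ : ℤˣ
  axis : Fin 2
  sgn : ℤˣ

namespace VertexGuard

variable {k : ℕ}

/-- Where the guard stands. -/
def pos (H : Fin k → Rect) (g : VertexGuard k) : Plane := (H g.hole).vertex g.σ g.τ

/-- The direction in which the guard looks. -/
def facing (H : Fin k → Rect) (g : VertexGuard k) : Plane :=
  ((g.sgn : ℤ) : ℝ) • (H g.hole).side g.axis

/-- The guard sees `x`: the point lies in the closed half-plane in front of the guard, and the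
line segment from the guard to the point stays in the polygonal region. -/
def Sees (lo hi : Plane) (H : Fin k → Rect) (g : VertexGuard k) (x : Plane) : Prop :=
  0 ≤ inner ℝ (g.facing H) (x - g.pos H) ∧ segment ℝ (g.pos H) x ⊆ region lo hi H

end VertexGuard

/-- A finite set of vertex guards guards the polygon: it sees every point of the region. -/
def IsGuarding {k : ℕ} (lo hi : Plane) (H : Fin k → Rect) (G : Finset (VertexGuard k)) : Prop :=
  ∀ x ∈ region lo hi H, ∃ g ∈ G, g.Sees lo hi H x

/-! Each new hole is a thin, slightly tilted sliver resting just above the right half of the top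
side of the previous hole, inside the strip over that side. When the tilt is small enough, all
earlier vertices lie strictly inside the lines through the right and top sides of the sliver, and
all of them except the two top vertices of the previous hole are hidden from the lowest vertex of
the sliver (`Rect.exists_sliver`, iterated in `exists_chain`).

The lower bound uses `3 * k + 1` witness points: one just outside the left, right and bottom side of
every hole, and one above the last hole. The left and bottom witnesses sit close to the lowest
vertex. Each witness can be visible only from the two ends of its side and, for left and bottom
witnesses, from the top left respectively top right vertex of the previous hole. The half-plane
condition then decides: a guard facing outward along `p` or inward along `q` can see only the left
or right witness of its own hole. Any other guard can see only its own bottom witness if it stands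
at a bottom vertex, and only a witness in the gap above its hole if it stands at a top vertex: the
left or the bottom one of the next hole, according to its end of the top side, or the final one. So
no guard sees two witnesses (`exists_witness_target`), and the bound follows by counting.

Some finite set does guard the region, because every point sees a hole vertex
(`exists_visible_vertex`). -/

namespace Rect

/-! ### Coordinates in the frame of a rectangle. -/

/-- The first coordinate in the frame of the rectangle; the sides have the values `-1` and `1`. -/
noncomputable def X (R : Rect) (x : Plane) : ℝ :=
  inner ℝ R.p (x - R.center) / inner ℝ R.p R.p

/-- The second coordinate in the frame of the rectangle. -/
noncomputable def Y (R : Rect) (x : Plane) : ℝ :=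
  inner ℝ R.q (x - R.center) / inner ℝ R.q R.q

variable (R : Rect)

theorem inner_p_pos : 0 < inner ℝ R.p R.p := real_inner_self_pos.2 R.p_ne_zero

theorem inner_q_pos : 0 < inner ℝ R.q R.q := real_inner_self_pos.2 R.q_ne_zero

@[fun_prop]
theorem continuous_X : Continuous R.X := by unfold X; fun_prop

@[fun_prop]
theorem continuous_Y : Continuous R.Y := by unfold Y; fun_prop

theorem orthogonal' : inner ℝ R.q R.p = 0 := by rw [real_inner_comm, R.orthogonal]

theorem X_pt (a b : ℝ) : R.X (R.center + a • R.p + b • R.q) = a := by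
  have h := R.inner_p_pos.ne'
  have : R.center + a • R.p + b • R.q - R.center = a • R.p + b • R.q := by abel
  rw [X, this, inner_add_right, inner_smul_right, inner_smul_right, R.orthogonal]
  field_simp
  ring

theorem Y_pt (a b : ℝ) : R.Y (R.center + a • R.p + b • R.q) = b := by
  have h := R.inner_q_pos.ne'
  have : R.center + a • R.p + b • R.q - R.center = a • R.p + b • R.q := by abel
  rw [Y, this, inner_add_right, inner_smul_right, inner_smul_right, R.orthogonal']
  field_simp
  ring

theorem X_vertex (σ τ : ℤˣ) : R.X (R.vertex σ τ) = ((σ : ℤ) : ℝ) := R.X_pt _ _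

theorem Y_vertex (σ τ : ℤˣ) : R.Y (R.vertex σ τ) = ((τ : ℤ) : ℝ) := R.Y_pt _ _

/-- In dimension two, orthogonality makes `q` a multiple `μ` of `p` rotated by a right angle;
substituting this leaves an identity of rational functions. -/
theorem eq_pt (x : Plane) : x = R.center + R.X x • R.p + R.Y x • R.q := by
  have hp := R.inner_p_pos
  have hq := R.inner_q_pos
  have ho := R.orthogonal
  obtain ⟨d, rfl⟩ : ∃ d, x = R.center + d := ⟨x - R.center, by abel⟩
  simp only [X, Y, add_sub_cancel_left]
  generalize R.p = p at *
  generalize R.q = q at *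
  simp only [PiLp.inner_apply, Fin.sum_univ_two, RCLike.inner_apply, conj_trivial] at *
  -- Lagrange's identity; the squared inner product vanishes by `ho`. It shows that the determinant
  -- is nonzero.
  have key : (p 0 * q 1 - p 1 * q 0) ^ 2 = (p 0 * p 0 + p 1 * p 1) * (q 0 * q 0 + q 1 * q 1) := by
    linear_combination (-(q 0 * p 0 + q 1 * p 1)) * ho
  set D := p 0 * q 1 - p 1 * q 0 with hD
  have hD0 : D ≠ 0 := by
    intro h0
    rw [h0] at key
    have := mul_pos hp hq
    nlinarith
  set N := p 0 * p 0 + p 1 * p 1 with hN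
  have e0 : q 0 = -(D / N) * p 1 := by
    field_simp
    rw [hD, hN]
    linear_combination (p 0) * ho
  have e1 : q 1 = (D / N) * p 0 := by
    field_simp
    rw [hD, hN]
    linear_combination (p 1) * ho
  generalize D / N = μ at *
  have hμ : μ ≠ 0 := by
    rintro rfl
    rw [e0, e1] at hq
    simp at hq
  have hq' : q 0 * q 0 + q 1 * q 1 = μ ^ 2 * N := by rw [e0, e1, hN]; ring
  rw [hq']
  have hN0 := hp.ne'
  ext i
  fin_cases i
  · simp only [Fin.zero_eta, PiLp.add_apply, PiLp.smul_apply, smul_eq_mul]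
    rw [e0, e1]
    field_simp
    rw [hN]
    ring
  · simp only [Fin.mk_one, PiLp.add_apply, PiLp.smul_apply, smul_eq_mul]
    rw [e0, e1]
    field_simp
    rw [hN]
    ring

theorem mem_carrier {x : Plane} : x ∈ R.carrier ↔ |R.X x| ≤ 1 ∧ |R.Y x| ≤ 1 := by
  constructor
  · rintro ⟨s, t, hs, ht, rfl⟩
    rw [X_pt, Y_pt]
    exact ⟨hs, ht⟩
  · rintro ⟨hs, ht⟩
    exact ⟨_, _, hs, ht, R.eq_pt x⟩

theorem vertex_mem_carrier (σ τ : ℤˣ) : R.vertex σ τ ∈ R.carrier := by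
  rw [mem_carrier, X_vertex, Y_vertex]
  rcases Int.units_eq_one_or σ with rfl | rfl <;> rcases Int.units_eq_one_or τ with rfl | rfl <;>
    simp

theorem isClosed_carrier : IsClosed R.carrier := by
  have : R.carrier = {x | |R.X x| ≤ 1} ∩ {x | |R.Y x| ≤ 1} := by
    ext x; exact R.mem_carrier
  rw [this]
  exact (isClosed_le (by fun_prop) continuous_const).inter
    (isClosed_le (by fun_prop) continuous_const)

theorem X_combo (v w : Plane) {a b : ℝ} (h : a + b = 1) :
    R.X (a • v + b • w) = a * R.X v + b * R.X w := by
  have : a • v + b • w - R.center = a • (v - R.center) + b • (w - R.center) := by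
    have : R.center = (a + b) • R.center := by rw [h, one_smul]
    rw [add_smul] at this
    nth_rw 1 [this]
    module
  rw [X, this, inner_add_right, inner_smul_right, inner_smul_right, X, X]
  ring

theorem Y_combo (v w : Plane) {a b : ℝ} (h : a + b = 1) :
    R.Y (a • v + b • w) = a * R.Y v + b * R.Y w := by
  have : a • v + b • w - R.center = a • (v - R.center) + b • (w - R.center) := by
    have : R.center = (a + b) • R.center := by rw [h, one_smul]
    rw [add_smul] at this
    nth_rw 1 [this]
    module
  rw [Y, this, inner_add_right, inner_smul_right, inner_smul_right, Y, Y]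
  ring

theorem abs_lt_one_of_nhds {a : ℝ} (h : ∀ᶠ e in nhds (0 : ℝ), |a + e| ≤ 1) : |a| < 1 := by
  obtain ⟨ε, hε, h⟩ := Metric.eventually_nhds_iff.1 h
  have h1 := @h (ε / 2) (by rw [Real.dist_eq, sub_zero, abs_of_pos (by linarith)]; linarith)
  have h2 := @h (-(ε / 2)) (by
    rw [Real.dist_eq, sub_zero, abs_neg, abs_of_pos (by linarith)]; linarith)
  rw [abs_le] at h1 h2
  rw [abs_lt]
  constructor <;> linarith

theorem mem_interior {x : Plane} :
    x ∈ interior R.carrier ↔ |R.X x| < 1 ∧ |R.Y x| < 1 := by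
  constructor
  · intro hx
    have hn : R.carrier ∈ nhds x := mem_interior_iff_mem_nhds.1 hx
    have aux : ∀ u : Plane, ∀ᶠ e in nhds (0 : ℝ), x + e • u ∈ R.carrier := by
      intro u
      have hc : Filter.Tendsto (fun e : ℝ => x + e • u) (nhds 0) (nhds x) := by
        have : Continuous fun e : ℝ => x + e • u := by fun_prop
        simpa using this.tendsto 0
      exact hc hn
    constructor
    · apply abs_lt_one_of_nhds
      filter_upwards [aux R.p] with e he
      have h1 := ((R.mem_carrier).1 he).1
      have : x + e • R.p = R.center + (R.X x + e) • R.p + R.Y x • R.q := by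
        nth_rw 1 [R.eq_pt x]; module
      rwa [this, X_pt] at h1
    · apply abs_lt_one_of_nhds
      filter_upwards [aux R.q] with e he
      have h1 := ((R.mem_carrier).1 he).2
      have : x + e • R.q = R.center + R.X x • R.p + (R.Y x + e) • R.q := by
        nth_rw 1 [R.eq_pt x]; module
      rwa [this, Y_pt] at h1
  · intro hx
    have ho : IsOpen ({x | |R.X x| < 1} ∩ {x | |R.Y x| < 1}) :=
      (isOpen_lt (by fun_prop) continuous_const).inter
        (isOpen_lt (by fun_prop) continuous_const)
    exact interior_maximal (fun y hy => R.mem_carrier.2 ⟨le_of_lt hy.1, le_of_lt hy.2⟩) ho hx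

/-! ### Blocked lines of sight. -/

/-- The segment from `v` to `x` meets the interior of the rectangle. -/
def Blocks (v x : Plane) : Prop := ∃ z ∈ segment ℝ v x, z ∈ interior R.carrier

/-- This openness lets hiddenness survive small perturbations: raising the lowest vertex of a sliver
off a top side, and pushing a witness off a boundary. -/
theorem isOpen_blocks (v : Plane) : IsOpen {x | R.Blocks v x} := by
  rw [isOpen_iff_mem_nhds]
  rintro x ⟨z, ⟨a, b, ha, hb, hab, rfl⟩, hz⟩
  have hc : Continuous fun y : Plane => a • v + b • y := by fun_prop
  have : (fun y : Plane => a • v + b • y) ⁻¹' interior R.carrier ∈ nhds x :=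
    (isOpen_interior.preimage hc).mem_nhds hz
  filter_upwards [this] with y hy
  exact ⟨_, ⟨a, b, ha, hb, hab, rfl⟩, hy⟩

theorem eventually_abs_combo_lt {a c : ℝ} (h : |a| < 1 ∨ (a = 1 ∧ c < 1) ∨ (a = -1 ∧ -1 < c)) :
    ∀ᶠ e in nhdsWithin (0 : ℝ) (Set.Ioi 0), |e * c + (1 - e) * a| < 1 := by
  have hc : ∀ d : ℝ, Filter.Tendsto (fun e : ℝ => e * c + (1 - e) * a + e * d)
      (nhdsWithin 0 (Set.Ioi 0)) (nhds a) := by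
    intro d
    have : Continuous fun e : ℝ => e * c + (1 - e) * a + e * d := by fun_prop
    have h0 := (this.tendsto 0).mono_left (nhdsWithin_le_nhds (s := Set.Ioi (0 : ℝ)))
    simpa using h0
  rcases h with h | ⟨rfl, h⟩ | ⟨rfl, h⟩
  · have := (hc 0).eventually (isOpen_lt continuous_abs continuous_const |>.mem_nhds h)
    simpa using this
  · have h1 := (hc 0).eventually (lt_mem_nhds (show (-1 : ℝ) < 1 by norm_num))
    filter_upwards [h1, self_mem_nhdsWithin] with e he hpos
    have hpos : 0 < e := hpos
    rw [abs_lt]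
    constructor
    · linarith
    · nlinarith
  · have h1 := (hc 0).eventually (gt_mem_nhds (show (-1 : ℝ) < 1 by norm_num))
    filter_upwards [h1, self_mem_nhdsWithin] with e he hpos
    have hpos : 0 < e := hpos
    rw [abs_lt]
    constructor
    · nlinarith
    · linarith

/-- A point `v` strictly on the inner side of each side of the rectangle on which the boundary
point `x` lies does not see `x`. -/
theorem blocks_of_inside {v x : Plane}
    (hX : |R.X x| < 1 ∨ (R.X x = 1 ∧ R.X v < 1) ∨ (R.X x = -1 ∧ -1 < R.X v))
    (hY : |R.Y x| < 1 ∨ (R.Y x = 1 ∧ R.Y v < 1) ∨ (R.Y x = -1 ∧ -1 < R.Y v)) :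
    R.Blocks v x := by
  have h1 : ∀ᶠ e in nhdsWithin (0 : ℝ) (Set.Ioi 0), e < 1 :=
    (gt_mem_nhds (show (0 : ℝ) < 1 by norm_num)).filter_mono nhdsWithin_le_nhds
  obtain ⟨e, ⟨he1, he2⟩, he3, he4⟩ := (((eventually_abs_combo_lt hX).and
    (eventually_abs_combo_lt hY)).and (h1.and self_mem_nhdsWithin)).exists
  have he4 : 0 < e := he4
  have hs : e + (1 - e) = 1 := by ring
  refine ⟨e • v + (1 - e) • x, ⟨e, 1 - e, he4.le, by linarith, hs, rfl⟩, ?_⟩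
  rw [mem_interior, R.X_combo _ _ hs, R.Y_combo _ _ hs]
  exact ⟨he1, he2⟩

end Rect

/-! ### The tilted sliver above the top side. -/

namespace Rect

/-- A vector of the length of `R.p` and the direction of `R.q`. -/
noncomputable def f (R : Rect) : Plane := (‖R.p‖ / ‖R.q‖) • R.q

variable (R : Rect)

theorem ratio_pos : 0 < ‖R.p‖ / ‖R.q‖ :=
  div_pos (norm_pos_iff.2 R.p_ne_zero) (norm_pos_iff.2 R.q_ne_zero)

theorem inner_p_f : inner ℝ R.p R.f = 0 := by
  rw [f, inner_smul_right, R.orthogonal, mul_zero]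

theorem inner_f_p : inner ℝ R.f R.p = 0 := by rw [real_inner_comm, R.inner_p_f]

theorem inner_f_f : inner ℝ R.f R.f = inner ℝ R.p R.p := by
  have : ‖R.q‖ ≠ 0 := norm_ne_zero_iff.2 R.q_ne_zero
  rw [f, inner_smul_right, inner_smul_left, real_inner_self_eq_norm_sq,
    real_inner_self_eq_norm_sq]
  simp only [conj_trivial]
  field_simp

theorem inner_tilt (t : ℝ) :
    inner ℝ (R.p + t • R.f) (R.p + t • R.f) = (1 + t ^ 2) * inner ℝ R.p R.p := by
  simp only [inner_add_left, inner_add_right, inner_smul_left, inner_smul_right, R.inner_p_f,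
    R.inner_f_p, R.inner_f_f, conj_trivial]
  ring

theorem inner_tilt' (t : ℝ) :
    inner ℝ (R.f - t • R.p) (R.f - t • R.p) = (1 + t ^ 2) * inner ℝ R.p R.p := by
  simp only [inner_sub_left, inner_sub_right, inner_smul_left, inner_smul_right, R.inner_p_f,
    R.inner_f_p, R.inner_f_f, conj_trivial]
  ring

/-- Half of the width of the sliver of tilt `t`. -/
noncomputable def width (t : ℝ) : ℝ := 1 / 2 - t ^ 2 / 4

/-- A rectangle of tilt `t` whose lowest vertex lies slightly above the midpoint of the top side
of `R`, and whose thickness is proportional to `t`. -/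
noncomputable def sliver (t : ℝ) (h0 : 0 < t) (h1 : t < 1) : Rect where
  center := R.center + R.q + (t / 2) • R.f + width t • (R.p + t • R.f) + t • (R.f - t • R.p)
  p := width t • (R.p + t • R.f)
  q := t • (R.f - t • R.p)
  p_ne_zero := by
    refine smul_ne_zero (by unfold width; nlinarith) ?_
    rw [← real_inner_self_pos, inner_tilt]
    exact mul_pos (by positivity) R.inner_p_pos
  q_ne_zero := by
    refine smul_ne_zero h0.ne' ?_
    rw [← real_inner_self_pos, inner_tilt']
    exact mul_pos (by positivity) R.inner_p_pos
  orthogonal := by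
    simp only [inner_add_left, inner_sub_right, inner_smul_left, inner_smul_right, R.inner_p_f,
      R.inner_f_p, R.inner_f_f, conj_trivial]
    ring

/-- The second coordinate of a point, in the unit of `R.f` and from the top side of `R`. -/
noncomputable def height (x : Plane) : ℝ := (R.Y x - 1) / (‖R.p‖ / ‖R.q‖)

theorem eq_top_pt (x : Plane) :
    x = R.center + R.q + R.X x • R.p + R.height x • R.f := by
  have h := R.ratio_pos.ne'
  rw [height, f, smul_smul, div_mul_cancel₀ _ h]
  nth_rw 1 [R.eq_pt x]
  module

theorem X_top_pt (a b : ℝ) : R.X (R.center + R.q + a • R.p + b • R.f) = a := by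
  rw [f, smul_smul]
  convert R.X_pt a (1 + b * (‖R.p‖ / ‖R.q‖)) using 2
  module

theorem Y_top_pt (a b : ℝ) :
    R.Y (R.center + R.q + a • R.p + b • R.f) = 1 + b * (‖R.p‖ / ‖R.q‖) := by
  rw [f, smul_smul]
  convert R.Y_pt a (1 + b * (‖R.p‖ / ‖R.q‖)) using 2
  module

theorem X_sliver {t : ℝ} (h0 : 0 < t) (h1 : t < 1) (x : Plane) :
    (R.sliver t h0 h1).X x =
      (R.X x + t * R.height x - t * (t / 2)) / (width t * (1 + t ^ 2)) - 1 := by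
  have hw : width t ≠ 0 := by unfold width; nlinarith
  have hN := R.inner_p_pos.ne'
  have ht : 1 + t ^ 2 ≠ 0 := by positivity
  have e : x - (R.sliver t h0 h1).center = R.X x • R.p + (R.height x - t / 2) • R.f
      - width t • (R.p + t • R.f) - t • (R.f - t • R.p) := by
    nth_rw 1 [R.eq_top_pt x]
    simp only [sliver]
    module
  rw [X, e]
  simp only [sliver, inner_smul_left, inner_smul_right, inner_tilt, inner_sub_right]
  simp only [inner_add_left, inner_add_right, inner_smul_left, inner_smul_right, R.inner_p_f,
      R.inner_f_p, R.inner_f_f, conj_trivial]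
  field_simp
  ring

theorem Y_sliver {t : ℝ} (h0 : 0 < t) (h1 : t < 1) (x : Plane) :
    (R.sliver t h0 h1).Y x =
      (R.height x - t * R.X x - t / 2) / (t * (1 + t ^ 2)) - 1 := by
  have hN := R.inner_p_pos.ne'
  have ht : 1 + t ^ 2 ≠ 0 := by positivity
  have ht0 := h0.ne'
  have e : x - (R.sliver t h0 h1).center = R.X x • R.p + (R.height x - t / 2) • R.f
      - width t • (R.p + t • R.f) - t • (R.f - t • R.p) := by
    nth_rw 1 [R.eq_top_pt x]
    simp only [sliver]
    module
  rw [Y, e]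
  simp only [sliver, inner_smul_left, inner_smul_right, inner_tilt']
  simp only [inner_sub_left, inner_sub_right, inner_add_right, inner_smul_left, inner_smul_right, R.inner_p_f,
      R.inner_f_p, R.inner_f_f, conj_trivial]
  field_simp
  ring

/-- This and `carrier_sliver_above` dictate `width`: `2 * width t < 1` keeps the sliver within the
strip over `R`, while `2 * width t * (1 + t ^ 2) > 1 - t ^ 2 / 2` puts the whole of `R` strictly
inside the line through its right side. -/
theorem X_sliver_lt_one {t : ℝ} (h0 : 0 < t) (h1 : t < 1) {x : Plane} (hX : R.X x ≤ 1)
    (hY : R.Y x ≤ 1) : (R.sliver t h0 h1).X x < 1 := by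
  have hw : 0 < width t := by unfold width; nlinarith
  have hh : R.height x ≤ 0 := div_nonpos_of_nonpos_of_nonneg (by linarith) R.ratio_pos.le
  rw [X_sliver, sub_lt_iff_lt_add, div_lt_iff₀ (by positivity)]
  have : t * R.height x ≤ 0 := mul_nonpos_of_nonneg_of_nonpos h0.le hh
  have h2 : t ^ 2 < 1 := by nlinarith
  have h3 : 0 < t ^ 2 := by positivity
  unfold width
  nlinarith

theorem sliver_vertex_eq {t : ℝ} (h0 : 0 < t) (h1 : t < 1) :
    (R.sliver t h0 h1).vertex (-1) (-1) = R.center + R.q + (t / 2) • R.f := by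
  simp only [vertex, sliver]
  push_cast
  module

/-- At `t = 0` the sliver collapses to the right half of the top side of `R`, which lies in `U`;
compactness of the parameter square extends this to small `t`. -/
theorem eventually_carrier_sliver_subset {U : Set Plane} (hU : IsOpen U) (h : R.carrier ⊆ U) :
    ∀ᶠ t in nhdsWithin (0 : ℝ) (Set.Ioi 0), ∀ h0 h1, (R.sliver t h0 h1).carrier ⊆ U := by
  let F : ℝ × (ℝ × ℝ) → Plane := fun z =>
    R.center + R.q + (z.1 / 2) • R.f + width z.1 • (R.p + z.1 • R.f) + z.1 • (R.f - z.1 • R.p)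
      + z.2.1 • (width z.1 • (R.p + z.1 • R.f)) + z.2.2 • (z.1 • (R.f - z.1 • R.p))
  have hF : Continuous F := by
    simp only [F, width]
    fun_prop
  have hK : IsCompact (Set.Icc (-1 : ℝ) 1 ×ˢ Set.Icc (-1 : ℝ) 1) := isCompact_Icc.prod isCompact_Icc
  have key : ∀ᶠ t in nhds (0 : ℝ), ∀ y ∈ Set.Icc (-1 : ℝ) 1 ×ˢ Set.Icc (-1 : ℝ) 1,
      F (t, y) ∈ U := by
    refine hK.eventually_forall_of_forall_eventually fun y hy => ?_
    refine (hU.preimage hF).mem_nhds (h ?_)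
    obtain ⟨⟨hy1, hy2⟩, -⟩ := hy
    refine ⟨(1 + y.1) / 2, 1, ?_, by simp, ?_⟩
    · rw [abs_le]; constructor <;> linarith
    · simp only [F, width]
      module
  filter_upwards [key.filter_mono nhdsWithin_le_nhds] with t ht h0 h1
  rintro x ⟨s, u, hs, hu, rfl⟩
  exact ht (s, u) ⟨abs_le.1 hs, abs_le.1 hu⟩

theorem carrier_sliver_above {t : ℝ} (h0 : 0 < t) (h1 : t < 1 / 2) (h1' : t < 1) {x : Plane}
    (hx : x ∈ (R.sliver t h0 h1').carrier) : |R.X x| < 1 ∧ 1 < R.Y x := by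
  obtain ⟨s, u, hs, hu, rfl⟩ := hx
  rw [abs_le] at hs hu
  have e : (R.sliver t h0 h1').center + s • (R.sliver t h0 h1').p + u • (R.sliver t h0 h1').q
      = R.center + R.q + ((1 + s) * width t - (1 + u) * t ^ 2) • R.p
        + (t / 2 + (1 + s) * width t * t + (1 + u) * t) • R.f := by
    simp only [sliver]
    module
  have hw : 0 < width t := by unfold width; nlinarith
  have hw1 : 2 * width t < 1 := by unfold width; nlinarith
  have a1 : 0 ≤ 1 + s := by linarith
  have a2 : 0 ≤ 1 + u := by linarith
  rw [e, X_top_pt, Y_top_pt, abs_lt]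
  refine ⟨⟨?_, ?_⟩, ?_⟩
  · have : 0 ≤ (1 + s) * width t := by positivity
    nlinarith
  · have : 0 ≤ (1 + u) * t ^ 2 := by positivity
    nlinarith
  · have := R.ratio_pos
    have : 0 < (t / 2 + (1 + s) * width t * t + (1 + u) * t) * (‖R.p‖ / ‖R.q‖) := by positivity
    linarith

/-- As `t` tends to `0`, the line through the top side of the sliver approaches that of `R`, and `v`
is strictly below the latter. -/
theorem eventually_Y_sliver_lt_one {v : Plane} (hv : R.Y v < 1) :
    ∀ᶠ t in nhdsWithin (0 : ℝ) (Set.Ioi 0), ∀ h0 h1, (R.sliver t h0 h1).Y v < 1 := by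
  have hh : R.height v < 0 := div_neg_of_neg_of_pos (by linarith) R.ratio_pos
  -- The desired inequality with its denominator cleared, so that it also makes sense at `t = 0`.
  have hc : Continuous fun t : ℝ => R.height v - t * R.X v - t / 2 - 2 * (t * (1 + t ^ 2)) := by
    fun_prop
  have := hc.continuousAt.eventually_lt_const
    (show R.height v - 0 * R.X v - 0 / 2 - 2 * (0 * (1 + 0 ^ 2)) < 0 by simpa using hh)
  filter_upwards [this.filter_mono nhdsWithin_le_nhds] with t ht h0 h1
  rw [Y_sliver, sub_lt_iff_lt_add, div_lt_iff₀ (by positivity)]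
  linarith

/-- The lowest vertex tends to the midpoint of the top side of `R`, which `R` itself hides from
everything strictly below that side. -/
theorem eventually_blocks_sliver_vertex {v : Plane} (hv : R.Y v < 1) :
    ∀ᶠ t in nhdsWithin (0 : ℝ) (Set.Ioi 0), ∀ h0 h1,
      R.Blocks v ((R.sliver t h0 h1).vertex (-1) (-1)) := by
  have hm : R.Blocks v (R.center + R.q) := by
    have hX := R.X_pt 0 1
    have hY := R.Y_pt 0 1
    rw [one_smul, zero_smul, add_zero] at hX hY
    exact R.blocks_of_inside (Or.inl (by simp [hX])) (Or.inr (Or.inl ⟨hY, hv⟩))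
  have hc : Continuous fun t : ℝ => R.center + R.q + (t / 2) • R.f := by fun_prop
  have := (hc.tendsto 0).eventually ((R.isOpen_blocks v).mem_nhds (by simpa using hm))
  filter_upwards [this.filter_mono nhdsWithin_le_nhds] with t ht h0 h1
  rw [sliver_vertex_eq]
  exact ht

theorem exists_sliver {U : Set Plane} (hU : IsOpen U) (h : R.carrier ⊆ U) {O : Set Plane}
    (hO : O.Finite) (hOX : ∀ v ∈ O, R.X v ≤ 1) (hOY : ∀ v ∈ O, R.Y v < 1) :
    ∃ B : Rect, B.carrier ⊆ U ∧ (∀ x ∈ B.carrier, |R.X x| < 1 ∧ 1 < R.Y x) ∧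
      (∀ v ∈ O, B.X v < 1 ∧ B.Y v < 1 ∧ R.Blocks v (B.vertex (-1) (-1))) ∧
      (∀ σ, B.X (R.vertex σ 1) < 1 ∧ B.Y (R.vertex σ 1) < 1) ∧
      -1 < B.Y (R.vertex (-1) 1) ∧ -1 < B.X (R.vertex 1 1) := by
  have hsmall : ∀ᶠ t in nhdsWithin (0 : ℝ) (Set.Ioi 0), t < 1 / 2 :=
    (gt_mem_nhds (show (0 : ℝ) < 1 / 2 by norm_num)).filter_mono nhdsWithin_le_nhds
  have hpos : ∀ᶠ t in nhdsWithin (0 : ℝ) (Set.Ioi 0), 0 < t := self_mem_nhdsWithin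
  have e1 := hO.eventually_all.2 fun v hv => R.eventually_Y_sliver_lt_one (hOY v hv)
  have e2 := hO.eventually_all.2 fun v hv => R.eventually_blocks_sliver_vertex (hOY v hv)
  obtain ⟨t, ⟨⟨h0, h1⟩, hs⟩, ht1, ht2⟩ := (((hpos.and hsmall).and
    (R.eventually_carrier_sliver_subset hU h)).and (e1.and e2)).exists
  have h1' : t < 1 := by linarith
  have hw : 0 < width t := by unfold width; nlinarith
  have hh : ∀ σ, R.height (R.vertex σ 1) = 0 := by
    intro σ
    simp [height, Y_vertex]
  refine ⟨R.sliver t h0 h1', hs h0 h1', fun x hx => R.carrier_sliver_above h0 h1 h1' hx,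
    fun v hv => ⟨R.X_sliver_lt_one h0 h1' (hOX v hv) (hOY v hv).le, ht1 v hv h0 h1',
      ht2 v hv h0 h1'⟩, fun σ => ⟨R.X_sliver_lt_one h0 h1' ?_ ?_, ?_⟩, ?_, ?_⟩
  · rw [X_vertex]
    rcases Int.units_eq_one_or σ with rfl | rfl <;> norm_num
  · rw [Y_vertex]
    norm_num
  · rw [Y_sliver, hh, X_vertex, sub_lt_iff_lt_add, div_lt_iff₀ (by positivity)]
    have : 0 < t ^ 3 := by positivity
    rcases Int.units_eq_one_or σ with rfl | rfl <;> push_cast <;> nlinarith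
  -- The line through the bottom side of the sliver crosses the top side of `R` at `X = -1/2`, to
  -- the right of the top left vertex.
  · rw [Y_sliver, hh, X_vertex, lt_sub_iff_add_lt, neg_add_cancel]
    apply div_pos _ (by positivity)
    push_cast
    linarith
  -- The line through the left side of the sliver crosses the top side of `R` at `X = t ^ 2 / 2`, to
  -- the left of the top right vertex.
  · rw [X_sliver, hh, X_vertex, lt_sub_iff_add_lt, neg_add_cancel]
    apply div_pos _ (by positivity)
    push_cast
    nlinarith

end Rect

/-! ### The chain of holes. -/

/-- The hole `H i` lies in `U` and above the top sides of all earlier holes, the vertices of the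
earlier holes lie strictly inside its top and its right side, and those that are not the top
vertices of the previous hole are hidden from its lowest vertex by the previous hole. -/
structure ChainStep (U : Set Plane) (H : ℕ → Rect) (i : ℕ) : Prop where
  subset : (H i).carrier ⊆ U
  above : ∀ j < i, ∀ x ∈ (H i).carrier, |(H j).X x| < 1 ∧ 1 < (H j).Y x
  inside : ∀ j < i, ∀ σ τ, (H i).X ((H j).vertex σ τ) < 1 ∧ (H i).Y ((H j).vertex σ τ) < 1
  inside_bottom_left : ∀ j, j + 1 = i →
    -1 < (H i).Y ((H j).vertex (-1) 1) ∧ -1 < (H i).X ((H j).vertex 1 1)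
  hidden : ∀ j, j + 1 = i → ∀ l ≤ j, ∀ σ τ, ¬(l = j ∧ τ = 1) →
    (H j).Blocks ((H l).vertex σ τ) ((H i).vertex (-1) (-1))

theorem ChainStep.congr {U : Set Plane} {H H' : ℕ → Rect} {i : ℕ} (h : ChainStep U H i)
    (hH : ∀ j ≤ i, H' j = H j) : ChainStep U H' i where
  subset := by rw [hH i le_rfl]; exact h.subset
  above j hj := by rw [hH i le_rfl, hH j hj.le]; exact h.above j hj
  inside j hj := by rw [hH i le_rfl, hH j hj.le]; exact h.inside j hj
  inside_bottom_left j hj := by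
    rw [hH i le_rfl, hH j (by omega)]; exact h.inside_bottom_left j hj
  hidden j hj l hl := by
    rw [hH i le_rfl, hH j (by omega), hH l (by omega)]; exact h.hidden j hj l hl

theorem isOpen_above (R : Rect) : IsOpen {x | |R.X x| < 1 ∧ 1 < R.Y x} :=
  (isOpen_lt R.continuous_X.abs continuous_const).inter
    (isOpen_lt continuous_const R.continuous_Y)

theorem ChainStep.exists_next {U : Set Plane} (hU : IsOpen U) {H : ℕ → Rect} {n : ℕ}
    (h : ChainStep U H n) : ∃ H' : ℕ → Rect, (∀ i ≤ n, H' i = H i) ∧ ChainStep U H' (n + 1) := by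
  -- All vertices that the current hole has to hide from the next one: every vertex so far except
  -- its own two top vertices.
  let O : Set Plane := {v | ∃ j : Fin (n + 1), ∃ σ τ, ¬((j : ℕ) = n ∧ τ = 1) ∧
    v = (H j).vertex σ τ}
  have hO : O.Finite := by
    refine (Set.finite_range fun z : Fin (n + 1) × ℤˣ × ℤˣ =>
      (H z.1).vertex z.2.1 z.2.2).subset ?_
    rintro v ⟨j, σ, τ, -, rfl⟩
    exact ⟨(j, σ, τ), rfl⟩
  have hOXY : ∀ v ∈ O, (H n).X v ≤ 1 ∧ (H n).Y v < 1 := by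
    rintro v ⟨j, σ, τ, hj, rfl⟩
    rcases Nat.lt_succ_iff_lt_or_eq.1 j.2 with hlt | heq
    · exact ⟨(h.inside j hlt σ τ).1.le, (h.inside j hlt σ τ).2⟩
    · rw [heq, Rect.X_vertex, Rect.Y_vertex]
      rcases Int.units_eq_one_or τ with rfl | rfl
      · exact absurd ⟨heq, rfl⟩ hj
      · rcases Int.units_eq_one_or σ with rfl | rfl <;> norm_num
  have hV : IsOpen (U ∩ ⋂ j : Fin n, {x | |(H j).X x| < 1 ∧ 1 < (H j).Y x}) :=
    hU.inter (isOpen_iInter_of_finite fun j => isOpen_above _)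
  obtain ⟨B, hB, hBa, hBO, hBt, hBl⟩ := (H n).exists_sliver hV
    (fun x hx => ⟨h.subset hx, Set.mem_iInter.2 fun j => h.above j j.2 x hx⟩) hO
    (fun v hv => (hOXY v hv).1) (fun v hv => (hOXY v hv).2)
  have hBj : ∀ j ≤ n, Function.update H (n + 1) B j = H j := fun j hj =>
    Function.update_of_ne (by omega) _ _
  have hBn : Function.update H (n + 1) B (n + 1) = B := Function.update_self _ _ _
  refine ⟨Function.update H (n + 1) B, hBj, ⟨?_, ?_, ?_, ?_, ?_⟩⟩
  · rw [hBn]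
    exact fun x hx => (hB hx).1
  · intro j hj x hx
    rw [hBn] at hx
    rw [hBj j (by omega)]
    rcases Nat.lt_succ_iff_lt_or_eq.1 hj with hlt | rfl
    · exact Set.mem_iInter.1 (hB hx).2 ⟨j, hlt⟩
    · exact hBa x hx
  · intro j hj σ τ
    rw [hBn, hBj j (by omega)]
    by_cases hjn : j = n ∧ τ = 1
    · obtain ⟨rfl, rfl⟩ := hjn
      exact hBt σ
    · have := hBO _ ⟨⟨j, hj⟩, σ, τ, hjn, rfl⟩
      exact ⟨this.1, this.2.1⟩
  · intro j hj
    obtain rfl : j = n := by omega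
    rw [hBn, hBj j le_rfl]
    exact hBl
  · intro j hj l hl σ τ hlj
    obtain rfl : j = n := by omega
    rw [hBn, hBj j le_rfl, hBj l hl]
    exact (hBO _ ⟨⟨l, by omega⟩, σ, τ, hlj, rfl⟩).2.2

theorem exists_chain {U : Set Plane} (hU : IsOpen U) {R : Rect} (hR : R.carrier ⊆ U) (n : ℕ) :
    ∃ H : ℕ → Rect, ∀ i ≤ n, ChainStep U H i := by
  induction n with
  | zero =>
    refine ⟨fun _ => R, fun i hi => ?_⟩
    obtain rfl : i = 0 := by omega
    exact ⟨hR, by simp, by simp, by simp, by simp⟩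
  | succ n ih =>
    obtain ⟨H, hH⟩ := ih
    obtain ⟨H', hH', hn⟩ := (hH n le_rfl).exists_next hU
    refine ⟨H', fun i hi => ?_⟩
    rcases Nat.lt_succ_iff_lt_or_eq.1 (Nat.lt_succ_of_le hi) with hlt | rfl
    · exact (hH i (by omega)).congr fun j hj => hH' j (by omega)
    · exact hn

/-! ### The region of a chain and a finite guarding set. -/

theorem convex_axisRect (lo hi : Plane) : Convex ℝ (axisRect lo hi) := by
  intro x hx y hy a b ha hb hab i
  have h1 := hx i
  have h2 := hy i
  simp only [PiLp.add_apply, PiLp.smul_apply, smul_eq_mul]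
  have e1 : lo i = a * lo i + b * lo i := by rw [← add_mul, hab, one_mul]
  have e2 : hi i = a * hi i + b * hi i := by rw [← add_mul, hab, one_mul]
  constructor
  · rw [e1]
    exact add_le_add (mul_le_mul_of_nonneg_left h1.1 ha) (mul_le_mul_of_nonneg_left h2.1 hb)
  · rw [e2]
    exact add_le_add (mul_le_mul_of_nonneg_left h1.2 ha) (mul_le_mul_of_nonneg_left h2.2 hb)

section Chain

variable {lo hi : Plane} {H : ℕ → Rect} {k : ℕ}

theorem isRectWithHoles_of_chain (hlo : ∀ i, lo i < hi i)
    (hH : ∀ i < k, ChainStep (interior (axisRect lo hi)) H i) :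
    IsRectWithHoles lo hi fun i : Fin k => H i where
  lo_lt_hi := hlo
  hole_subset i := (hH i i.2).subset
  disjoint := by
    have key : ∀ i j : Fin k, i < j → Disjoint (H i).carrier (H j).carrier := by
      intro i j hij
      rw [Set.disjoint_left]
      intro x hxi hxj
      have h1 := ((hH j j.2).above i hij x hxj).2
      have h2 := (abs_le.1 ((H i).mem_carrier.1 hxi).2).2
      linarith
    intro i j hij
    rcases lt_or_gt_of_ne hij with h | h
    · exact key i j h
    · exact (key j i h).symm

theorem mem_region_iff {x : Plane} : x ∈ region lo hi (fun i : Fin k => H i) ↔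
    x ∈ axisRect lo hi ∧ ∀ i < k, ¬(|(H i).X x| < 1 ∧ |(H i).Y x| < 1) := by
  simp only [region, Set.mem_sdiff, Set.mem_iUnion, Rect.mem_interior, not_exists]
  exact and_congr_right fun _ => ⟨fun h i hi => h ⟨i, hi⟩, fun h i => h i i.2⟩

/-- Every point of the region sees a vertex of a hole. -/
theorem exists_visible_vertex (hk : 1 ≤ k)
    (hH : ∀ i < k, ChainStep (interior (axisRect lo hi)) H i) {x : Plane}
    (hx : x ∈ region lo hi (fun i : Fin k => H i)) :
    ∃ j : Fin k, ∃ σ τ, segment ℝ ((H j).vertex σ τ) x ⊆ region lo hi (fun i : Fin k => H i) := by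
  rw [mem_region_iff] at hx
  obtain ⟨hxP, hxH⟩ := hx
  -- `j` is the first hole for which `x` is left of, right of or below it; if there is none, `x` is
  -- above all holes and `j` is the last one.
  obtain ⟨j, hjk, hpre, hj⟩ : ∃ j < k, (∀ i < j, 1 ≤ (H i).Y x) ∧
      ((H j).X x ≤ -1 ∨ 1 ≤ (H j).X x ∨ (H j).Y x ≤ -1 ∨ (1 ≤ (H j).Y x ∧ j + 1 = k)) := by
    have hside : ∀ j < k, ¬((H j).X x ≤ -1 ∨ 1 ≤ (H j).X x ∨ (H j).Y x ≤ -1) →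
        1 ≤ (H j).Y x := by
      intro j hj hn
      push Not at hn
      by_contra hlt
      push Not at hlt
      exact hxH j hj ⟨abs_lt.2 ⟨hn.1, hn.2.1⟩, abs_lt.2 ⟨hn.2.2, hlt⟩⟩
    by_cases hex : ∃ j, j < k ∧ ((H j).X x ≤ -1 ∨ 1 ≤ (H j).X x ∨ (H j).Y x ≤ -1)
    · classical
      obtain ⟨h1, h2⟩ := Nat.find_spec hex
      refine ⟨Nat.find hex, h1, fun i hi => hside i (by omega) fun hn => ?_, by tauto⟩
      exact Nat.find_min hex hi ⟨by omega, hn⟩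
    · push Not at hex
      have hall : ∀ i < k, 1 ≤ (H i).Y x := fun i hi => hside i hi (by
        have := hex i hi
        push Not
        exact this)
      exact ⟨k - 1, by omega, fun i hi => hall i (by omega),
        Or.inr (Or.inr (Or.inr ⟨hall _ (by omega), by omega⟩))⟩
  -- A segment that stays beyond one side of hole `j` avoids all holes: both ends are above the
  -- earlier ones, and the later ones lie in the strip above hole `j`.
  have main : ∀ σ τ, (∀ z ∈ segment ℝ ((H j).vertex σ τ) x,
      (H j).X z ≤ -1 ∨ 1 ≤ (H j).X z ∨ (H j).Y z ≤ -1 ∨ (1 ≤ (H j).Y z ∧ j + 1 = k)) →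
      segment ℝ ((H j).vertex σ τ) x ⊆ region lo hi (fun i : Fin k => H i) := by
    intro σ τ hseg z hz
    rw [mem_region_iff]
    have hv := (H j).vertex_mem_carrier σ τ
    refine ⟨(convex_axisRect lo hi).segment_subset (interior_subset ((hH j hjk).subset hv)) hxP hz,
      fun i hik hint => ?_⟩
    have hzj := hseg z hz
    rcases lt_trichotomy i j with hij | rfl | hij
    · obtain ⟨a, b, ha, hb, hab, rfl⟩ := hz
      have h1 := ((hH j hjk).above i hij _ hv).2
      have h2 := hpre i hij
      have h3 := (abs_lt.1 hint.2).2
      rw [Rect.Y_combo _ _ _ hab] at h3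
      nlinarith
    · rw [abs_lt, abs_lt] at hint
      rcases hzj with h | h | h | h <;> linarith [hint.1.1, hint.1.2, hint.2.1, hint.2.2]
    · have hmem : z ∈ (H i).carrier := (H i).mem_carrier.2 ⟨hint.1.le, hint.2.le⟩
      obtain ⟨h1, h2⟩ := (hH i hik).above j hij z hmem
      rw [abs_lt] at h1
      rcases hzj with h | h | h | h
      · linarith [h1.1]
      · linarith [h1.2]
      · linarith
      · omega
  have hsum : ∀ {a b : ℝ} {c d e : ℝ}, 0 ≤ a → 0 ≤ b → a + b = 1 → c ≤ e → d ≤ e →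
      a * c + b * d ≤ e := by
    intro a b c d e ha hb hab hc hd
    have : e = a * e + b * e := by rw [← add_mul, hab, one_mul]
    rw [this]
    exact add_le_add (mul_le_mul_of_nonneg_left hc ha) (mul_le_mul_of_nonneg_left hd hb)
  have hsum' : ∀ {a b : ℝ} {c d e : ℝ}, 0 ≤ a → 0 ≤ b → a + b = 1 → e ≤ c → e ≤ d →
      e ≤ a * c + b * d := by
    intro a b c d e ha hb hab hc hd
    have := hsum ha hb hab (neg_le_neg hc) (neg_le_neg hd)
    linarith
  rcases hj with h | h | h | h
  · refine ⟨⟨j, hjk⟩, -1, 1, main _ _ ?_⟩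
    rintro z ⟨a, b, ha, hb, hab, rfl⟩
    left
    rw [Rect.X_combo _ _ _ hab, Rect.X_vertex]
    exact hsum ha hb hab (by norm_num) h
  · refine ⟨⟨j, hjk⟩, 1, 1, main _ _ ?_⟩
    rintro z ⟨a, b, ha, hb, hab, rfl⟩
    right; left
    rw [Rect.X_combo _ _ _ hab, Rect.X_vertex]
    exact hsum' ha hb hab (by norm_num) h
  · refine ⟨⟨j, hjk⟩, 1, -1, main _ _ ?_⟩
    rintro z ⟨a, b, ha, hb, hab, rfl⟩
    right; right; left
    rw [Rect.Y_combo _ _ _ hab, Rect.Y_vertex]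
    exact hsum ha hb hab (by norm_num) h
  · refine ⟨⟨j, hjk⟩, 1, 1, main _ _ ?_⟩
    rintro z ⟨a, b, ha, hb, hab, rfl⟩
    right; right; right
    rw [Rect.Y_combo _ _ _ hab, Rect.Y_vertex]
    exact ⟨hsum' ha hb hab (by norm_num) h.1, h.2⟩

instance : Finite (VertexGuard k) :=
  Finite.of_injective (fun g : VertexGuard k => (g.hole, g.σ, g.τ, g.axis, g.sgn)) (by
    rintro ⟨a, b, c, d, e⟩ ⟨a', b', c', d', e'⟩ h
    simp only [Prod.mk.injEq] at h
    obtain ⟨rfl, rfl, rfl, rfl, rfl⟩ := h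
    rfl)

theorem exists_isGuarding (hk : 1 ≤ k)
    (hH : ∀ i < k, ChainStep (interior (axisRect lo hi)) H i) :
    ∃ G : Finset (VertexGuard k), IsGuarding lo hi (fun i : Fin k => H i) G := by
  classical
  have := Fintype.ofFinite (VertexGuard k)
  refine ⟨Finset.univ, fun x hx => ?_⟩
  obtain ⟨j, σ, τ, hseg⟩ := exists_visible_vertex hk hH hx
  -- The half-planes of two opposite facing directions cover the plane.
  rcases le_total 0 (inner ℝ (H j).p (x - (H j).vertex σ τ)) with h | h
  · refine ⟨⟨j, σ, τ, 0, 1⟩, Finset.mem_univ _, ?_, hseg⟩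
    simpa [VertexGuard.facing, VertexGuard.pos, Rect.side] using h
  · refine ⟨⟨j, σ, τ, 0, -1⟩, Finset.mem_univ _, ?_, hseg⟩
    simpa [VertexGuard.facing, VertexGuard.pos, Rect.side] using h

/-! ### The witness points. -/

/-- The point `w` of the region lies above the holes before `H i`, and only those vertices of
holes that satisfy `E` may see it. -/
structure IsWitness (lo hi : Plane) (H : ℕ → Rect) (k i : ℕ) (E : ℕ → ℤˣ → ℤˣ → Prop)
    (w : Plane) : Prop where
  mem_region : w ∈ region lo hi (fun i : Fin k => H i)
  above : ∀ j < i, |(H j).X w| < 1 ∧ 1 < (H j).Y w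
  of_visible : ∀ j : Fin k, ∀ σ τ,
    segment ℝ ((H j).vertex σ τ) w ⊆ region lo hi (fun i : Fin k => H i) → E j σ τ

/-- The points that are hidden by holes from all vertices that do not satisfy `E`. -/
def hiddenSet (H : ℕ → Rect) (k : ℕ) (E : ℕ → ℤˣ → ℤˣ → Prop) : Set Plane :=
  {x | ∀ j : Fin k, ∀ σ τ, ¬E j σ τ → ∃ l : Fin k, (H l).Blocks ((H j).vertex σ τ) x}

theorem isOpen_hiddenSet (E : ℕ → ℤˣ → ℤˣ → Prop) : IsOpen (hiddenSet H k E) := by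
  simp only [hiddenSet, Set.ofPred_forall, Set.ofPred_exists]
  exact isOpen_iInter_of_finite fun j => isOpen_iInter_of_finite fun σ =>
    isOpen_iInter_of_finite fun τ => isOpen_iInter_of_finite fun _ =>
      isOpen_iUnion fun l => (H l).isOpen_blocks _

theorem exists_add_smul_mem {U : Set Plane} (hU : IsOpen U) {x : Plane} (hx : x ∈ U) (n : Plane) :
    ∃ δ : ℝ, 0 < δ ∧ δ < 1 ∧ x + δ • n ∈ U := by
  have hc : Continuous fun δ : ℝ => x + δ • n := by fun_prop
  have h1 := (hc.tendsto 0).eventually (hU.mem_nhds (by simpa using hx))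
  have h2 : ∀ᶠ δ : ℝ in nhds 0, δ < 1 := gt_mem_nhds (by norm_num)
  have h3 : ∀ᶠ δ in nhdsWithin (0 : ℝ) (Set.Ioi 0), 0 < δ := self_mem_nhdsWithin
  obtain ⟨δ, h, h'⟩ := (((h2.and h1).filter_mono nhdsWithin_le_nhds).and h3).exists
  exact ⟨δ, h', h.1, h.2⟩

/-- Apart from leaving `H i`, everything asked of a witness follows from open conditions that
already hold at the point `x` of the hole, so a small push along `n` suffices. -/
theorem exists_isWitness (hH : ∀ i < k, ChainStep (interior (axisRect lo hi)) H i) {i : ℕ}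
    (hik : i < k) {x n : Plane} (hx : x ∈ (H i).carrier) {E : ℕ → ℤˣ → ℤˣ → Prop}
    (hE : x ∈ hiddenSet H k E) (hn : ∀ δ : ℝ, 0 < δ → x + δ • n ∉ (H i).carrier) :
    ∃ δ : ℝ, 0 < δ ∧ IsWitness lo hi H k i E (x + δ • n) := by
  let V : Set Plane := (hiddenSet H k E ∩ interior (axisRect lo hi)) ∩
    ((⋂ j : Fin k, ⋂ _ : (j : ℕ) ≠ i, ((H j).carrier)ᶜ) ∩
      ⋂ j : Fin i, {x | |(H j).X x| < 1 ∧ 1 < (H j).Y x})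
  have hV : IsOpen V := ((isOpen_hiddenSet E).inter isOpen_interior).inter
    ((isOpen_iInter_of_finite fun j : Fin k => isOpen_iInter_of_finite fun _ =>
      (H j).isClosed_carrier.isOpen_compl).inter
      (isOpen_iInter_of_finite fun j : Fin i => isOpen_above _))
  have hdisj : ∀ j < k, j ≠ i → x ∉ (H j).carrier := by
    intro j hj hji hxj
    rcases lt_or_gt_of_ne hji with h | h
    · have h1 := ((hH i hik).above j h x hx).2
      have h2 := (abs_le.1 ((H j).mem_carrier.1 hxj).2).2
      linarith
    · have h1 := ((hH j hj).above i h x hxj).2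
      have h2 := (abs_le.1 ((H i).mem_carrier.1 hx).2).2
      linarith
  have hxV : x ∈ V := ⟨⟨hE, (hH i hik).subset hx⟩,
    Set.mem_iInter₂.2 fun j hj => hdisj j j.2 hj,
    Set.mem_iInter.2 fun j => (hH i hik).above j j.2 x hx⟩
  obtain ⟨δ, h0, -, ⟨hw1, hw2⟩, hw3, hw4⟩ := exists_add_smul_mem hV hxV n
  refine ⟨δ, h0, ⟨⟨interior_subset hw2, ?_⟩, fun j hj => Set.mem_iInter.1 hw4 ⟨j, hj⟩, ?_⟩⟩
  · simp only [Set.mem_iUnion, not_exists]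
    intro j hj
    by_cases hji : (j : ℕ) = i
    · exact hn δ h0 (hji ▸ interior_subset hj)
    · exact Set.mem_iInter₂.1 hw3 j hji (interior_subset hj)
  · intro j σ τ hseg
    by_contra hnE
    obtain ⟨l, z, hz, hzl⟩ := hw1 j σ τ hnE
    exact (hseg hz).2 (Set.mem_iUnion.2 ⟨l, hzl⟩)

end Chain

section Chain

variable {lo hi : Plane} {H : ℕ → Rect} {k : ℕ}

theorem pt_mem_carrier (R : Rect) {a b : ℝ} (ha : |a| ≤ 1) (hb : |b| ≤ 1) :
    R.center + a • R.p + b • R.q ∈ R.carrier := ⟨a, b, ha, hb, rfl⟩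

theorem unit_eq_neg_one_of_ne {σ : ℤˣ} (h : σ ≠ 1) : σ = -1 :=
  (Int.units_eq_one_or σ).resolve_left h

theorem unit_eq_one_of_ne {σ : ℤˣ} (h : σ ≠ -1) : σ = 1 :=
  (Int.units_eq_one_or σ).resolve_right h

/-- All vertices but the right ones of `H i` lie strictly inside the line through its right side,
earlier ones by `inside` and later ones by `above`, so `H i` blocks them itself. -/
theorem exists_right_witness (hH : ∀ i < k, ChainStep (interior (axisRect lo hi)) H i) {i : ℕ}
    (hik : i < k) : ∃ w, IsWitness lo hi H k i (fun j σ _ => j = i ∧ σ = 1) w ∧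
      1 < (H i).X w ∧ |(H i).Y w| < 1 := by
  have key := exists_isWitness (E := fun j σ _ => j = i ∧ σ = 1) (n := (H i).p) hH hik
    (pt_mem_carrier (H i) (a := 1) (b := 0) (by simp) (by simp)) ?_ ?_
  · obtain ⟨δ, h0, hw⟩ := key
    have e : (H i).center + (1 : ℝ) • (H i).p + (0 : ℝ) • (H i).q + δ • (H i).p
      = (H i).center + (1 + δ) • (H i).p + (0 : ℝ) • (H i).q := by module
    rw [e] at hw
    refine ⟨_, hw, ?_, ?_⟩
    · rw [Rect.X_pt]; linarith
    · rw [Rect.Y_pt]; simp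
  · intro j σ τ hE
    refine ⟨⟨i, hik⟩, (H i).blocks_of_inside (Or.inr (Or.inl ⟨Rect.X_pt _ _ _, ?_⟩))
      (Or.inl (by rw [Rect.Y_pt]; simp))⟩
    rcases lt_trichotomy (j : ℕ) i with h | h | h
    · exact ((hH i hik).inside j h σ τ).1
    · rw [unit_eq_neg_one_of_ne fun hσ => hE ⟨h, hσ⟩, h, Rect.X_vertex]
      norm_num
    · exact (abs_lt.1 ((hH j j.2).above i h _ ((H j).vertex_mem_carrier σ τ)).1).2
  · intro δ h0 hmem
    have e : (H i).center + (1 : ℝ) • (H i).p + (0 : ℝ) • (H i).q + δ • (H i).p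
      = (H i).center + (1 + δ) • (H i).p + (0 : ℝ) • (H i).q := by module
    rw [e, Rect.mem_carrier, Rect.X_pt, abs_le] at hmem
    linarith [hmem.1.2]

theorem exists_top_witness (hH : ∀ i < k, ChainStep (interior (axisRect lo hi)) H i) {i : ℕ}
    (hik : i + 1 = k) : ∃ w, IsWitness lo hi H k i (fun j _ τ => j = i ∧ τ = 1) w ∧
      |(H i).X w| < 1 ∧ 1 < (H i).Y w := by
  have hik' : i < k := by omega
  have key := exists_isWitness (E := fun j _ τ => j = i ∧ τ = 1) (n := (H i).q) hH hik'
    (pt_mem_carrier (H i) (a := 0) (b := 1) (by simp) (by simp)) ?_ ?_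
  · obtain ⟨δ, h0, hw⟩ := key
    have e : (H i).center + (0 : ℝ) • (H i).p + (1 : ℝ) • (H i).q + δ • (H i).q
      = (H i).center + (0 : ℝ) • (H i).p + (1 + δ) • (H i).q := by module
    rw [e] at hw
    refine ⟨_, hw, ?_, ?_⟩
    · rw [Rect.X_pt]; simp
    · rw [Rect.Y_pt]; linarith
  · intro j σ τ hE
    refine ⟨⟨i, hik'⟩, (H i).blocks_of_inside (Or.inl (by rw [Rect.X_pt]; simp))
      (Or.inr (Or.inl ⟨Rect.Y_pt _ _ _, ?_⟩))⟩
    rcases lt_trichotomy (j : ℕ) i with h | h | h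
    · exact ((hH i hik').inside j h σ τ).2
    · rw [unit_eq_neg_one_of_ne fun hτ => hE ⟨h, hτ⟩, h, Rect.Y_vertex]
      norm_num
    · omega
  · intro δ h0 hmem
    have e : (H i).center + (0 : ℝ) • (H i).p + (1 : ℝ) • (H i).q + δ • (H i).q
      = (H i).center + (0 : ℝ) • (H i).p + (1 + δ) • (H i).q := by module
    rw [e, Rect.mem_carrier, Rect.Y_pt] at hmem
    linarith [(abs_le.1 hmem.2).2]

/-- Near the lowest vertex of a hole there are points on its left and bottom sides that are hidden
from the vertices of all earlier holes but the top vertices of the previous hole. -/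
theorem exists_hidden_near_vertex (hH : ∀ i < k, ChainStep (interior (axisRect lo hi)) H i)
    {i : ℕ} (hik : i < k) (d : Plane) :
    ∃ δ : ℝ, 0 < δ ∧ δ < 1 ∧ (H i).vertex (-1) (-1) + δ • d ∈
      hiddenSet H k fun j _ τ => ¬(j < i ∧ ¬(j + 1 = i ∧ τ = 1)) := by
  refine exists_add_smul_mem (isOpen_hiddenSet _) ?_ d
  intro j σ τ h
  obtain ⟨hji, hτ⟩ := not_not.1 h
  obtain ⟨m, rfl⟩ : ∃ m, i = m + 1 := ⟨i - 1, by omega⟩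
  exact ⟨⟨m, by omega⟩, (hH _ hik).hidden m rfl j (by omega) σ τ fun h' => hτ ⟨by omega, h'.2⟩⟩

theorem exists_left_witness (hH : ∀ i < k, ChainStep (interior (axisRect lo hi)) H i) {i : ℕ}
    (hik : i < k) : ∃ w, IsWitness lo hi H k i
        (fun j σ τ => σ = -1 ∧ (j = i ∨ (j + 1 = i ∧ τ = 1))) w ∧
      (H i).X w < -1 ∧ |(H i).Y w| < 1 := by
  -- The base point slides up the left side from the lowest vertex, just enough to be interior to
  -- the side while staying hidden by the previous hole.
  obtain ⟨ε, hε, hε', hhid⟩ := exists_hidden_near_vertex hH hik (H i).q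
  have e0 : (H i).vertex (-1) (-1) + ε • (H i).q
      = (H i).center + (-1 : ℝ) • (H i).p + (-1 + ε) • (H i).q := by
    simp only [Rect.vertex]; push_cast; module
  have hε1 : |-1 + ε| < 1 := by rw [abs_lt]; constructor <;> linarith
  rw [e0] at hhid
  have key := exists_isWitness (E := fun j σ τ => σ = -1 ∧ (j = i ∨ (j + 1 = i ∧ τ = 1)))
    (n := -(H i).p) hH hik
    (pt_mem_carrier (H i) (a := -1) (b := -1 + ε) (by simp) hε1.le) ?_ ?_
  · obtain ⟨δ, h0, hw⟩ := key
    have e : (H i).center + (-1 : ℝ) • (H i).p + (-1 + ε) • (H i).q + δ • -(H i).p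
      = (H i).center + (-1 - δ) • (H i).p + (-1 + ε) • (H i).q := by module
    rw [e] at hw
    refine ⟨_, hw, ?_, ?_⟩
    · rw [Rect.X_pt]; linarith
    · rwa [Rect.Y_pt]
  · intro j σ τ hE
    -- Vertices inside the line through the left side are blocked by `H i`; the rest must belong to
    -- earlier holes and are hidden by the previous hole.
    by_cases hin : -1 < (H i).X ((H j).vertex σ τ)
    · exact ⟨⟨i, hik⟩, (H i).blocks_of_inside (Or.inr (Or.inr ⟨Rect.X_pt _ _ _, hin⟩))
        (Or.inl (by rwa [Rect.Y_pt]))⟩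
    refine hhid j σ τ (not_not.2 ?_)
    rcases lt_trichotomy (j : ℕ) i with h | h | h
    · refine ⟨h, fun hj => ?_⟩
      rcases Int.units_eq_one_or σ with rfl | rfl
      · rw [hj.2] at hin
        exact hin ((hH i hik).inside_bottom_left j hj.1).2
      · exact hE ⟨rfl, Or.inr hj⟩
    · refine absurd ?_ hin
      rw [unit_eq_one_of_ne fun hσ => hE ⟨hσ, Or.inl h⟩, h, Rect.X_vertex]
      norm_num
    · exact absurd (abs_lt.1 ((hH j j.2).above i h _ ((H j).vertex_mem_carrier σ τ)).1).1 hin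
  · intro δ h0 hmem
    have e : (H i).center + (-1 : ℝ) • (H i).p + (-1 + ε) • (H i).q + δ • -(H i).p
      = (H i).center + (-1 - δ) • (H i).p + (-1 + ε) • (H i).q := by module
    rw [e, Rect.mem_carrier, Rect.X_pt, abs_le] at hmem
    linarith [hmem.1.1]

theorem exists_bottom_witness (hH : ∀ i < k, ChainStep (interior (axisRect lo hi)) H i) {i : ℕ}
    (hik : i < k) : ∃ w, IsWitness lo hi H k i
        (fun j σ τ => (j = i ∧ τ = -1) ∨ (j + 1 = i ∧ τ = 1 ∧ σ = 1)) w ∧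
      |(H i).X w| < 1 ∧ (H i).Y w < -1 := by
  obtain ⟨ε, hε, hε', hhid⟩ := exists_hidden_near_vertex hH hik (H i).p
  have e0 : (H i).vertex (-1) (-1) + ε • (H i).p
      = (H i).center + (-1 + ε) • (H i).p + (-1 : ℝ) • (H i).q := by
    simp only [Rect.vertex]; push_cast; module
  have hε1 : |-1 + ε| < 1 := by rw [abs_lt]; constructor <;> linarith
  rw [e0] at hhid
  have key := exists_isWitness
    (E := fun j σ τ => (j = i ∧ τ = -1) ∨ (j + 1 = i ∧ τ = 1 ∧ σ = 1))
    (n := -(H i).q) hH hik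
    (pt_mem_carrier (H i) (a := -1 + ε) (b := -1) hε1.le (by simp)) ?_ ?_
  · obtain ⟨δ, h0, hw⟩ := key
    have e : (H i).center + (-1 + ε) • (H i).p + (-1 : ℝ) • (H i).q + δ • -(H i).q
      = (H i).center + (-1 + ε) • (H i).p + (-1 - δ) • (H i).q := by module
    rw [e] at hw
    refine ⟨_, hw, ?_, ?_⟩
    · rwa [Rect.X_pt]
    · rw [Rect.Y_pt]; linarith
  · intro j σ τ hE
    -- The same dichotomy for the bottom side; here `inside_bottom_left` eliminates the top left
    -- vertex of the previous hole.
    by_cases hin : -1 < (H i).Y ((H j).vertex σ τ)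
    · exact ⟨⟨i, hik⟩, (H i).blocks_of_inside (Or.inl (by rwa [Rect.X_pt]))
        (Or.inr (Or.inr ⟨Rect.Y_pt _ _ _, hin⟩))⟩
    refine hhid j σ τ (not_not.2 ?_)
    rcases lt_trichotomy (j : ℕ) i with h | h | h
    · refine ⟨h, fun hj => ?_⟩
      rcases Int.units_eq_one_or σ with rfl | rfl
      · exact hE (Or.inr ⟨hj.1, hj.2, rfl⟩)
      · rw [hj.2] at hin
        exact hin ((hH i hik).inside_bottom_left j hj.1).1
    · refine absurd ?_ hin
      rw [unit_eq_one_of_ne fun hτ => hE (Or.inl ⟨h, hτ⟩), h, Rect.Y_vertex]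
      norm_num
    · have := ((hH j j.2).above i h _ ((H j).vertex_mem_carrier σ τ)).2
      exact absurd (by linarith) hin
  · intro δ h0 hmem
    have e : (H i).center + (-1 + ε) • (H i).p + (-1 : ℝ) • (H i).q + δ • -(H i).q
      = (H i).center + (-1 + ε) • (H i).p + (-1 - δ) • (H i).q := by module
    rw [e, Rect.mem_carrier, Rect.Y_pt] at hmem
    linarith [(abs_le.1 hmem.2).1]

/-! ### No guard sees two witnesses. -/

/-- The only witness that a guard may see: `none` is the one above the last hole, and
`some (i, s)` is the left, right or bottom one of the hole `i`, for `s = 0, 1, 2`. -/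
def VertexGuard.target (g : VertexGuard k) : Option (Fin k × Fin 3) :=
  if (g.axis = 0 ∧ g.sgn = g.σ) ∨ (g.axis = 1 ∧ g.sgn = -g.τ) then
    some (g.hole, if g.σ = -1 then 0 else 1)
  else if g.τ = -1 then some (g.hole, 2)
  else if h : (g.hole : ℕ) + 1 < k then some (⟨g.hole + 1, h⟩, if g.σ = -1 then 0 else 2)
  else none

theorem unit_eq_one_of_mul_nonneg {σ : ℤˣ} {r : ℝ} (h : 0 ≤ ((σ : ℤ) : ℝ) * r) (hr : 0 < r) :
    σ = 1 := by
  rcases Int.units_eq_one_or σ with rfl | rfl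
  · rfl
  · push_cast at h; linarith

theorem unit_eq_neg_one_of_mul_nonneg {σ : ℤˣ} {r : ℝ} (h : 0 ≤ ((σ : ℤ) : ℝ) * r)
    (hr : r < 0) : σ = -1 := by
  rcases Int.units_eq_one_or σ with rfl | rfl
  · push_cast at h; linarith
  · rfl

theorem unit_eq_neg_of_mul_nonneg {σ τ : ℤˣ} {y : ℝ}
    (h : 0 ≤ ((σ : ℤ) : ℝ) * (y - ((τ : ℤ) : ℝ))) (hy : |y| < 1) : σ = -τ := by
  rw [abs_lt] at hy
  rcases Int.units_eq_one_or τ with rfl | rfl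
  · exact unit_eq_neg_one_of_mul_nonneg h (by push_cast; linarith)
  · rw [neg_neg]
    exact unit_eq_one_of_mul_nonneg h (by push_cast; linarith)

theorem VertexGuard.Sees.coord {g : VertexGuard k} {w : Plane}
    (h : g.Sees lo hi (fun i : Fin k => H i) w) :
    (g.axis = 0 → 0 ≤ ((g.sgn : ℤ) : ℝ) * ((H g.hole).X w - ((g.σ : ℤ) : ℝ))) ∧
    (g.axis = 1 → 0 ≤ ((g.sgn : ℤ) : ℝ) * ((H g.hole).Y w - ((g.τ : ℤ) : ℝ))) := by
  have h1 := h.1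
  have e : w - (H g.hole).vertex g.σ g.τ =
      (w - (H g.hole).center) - ((H g.hole).vertex g.σ g.τ - (H g.hole).center) := by
    abel
  simp only [VertexGuard.facing, VertexGuard.pos, inner_smul_left, conj_trivial] at h1
  rw [e, inner_sub_right] at h1
  constructor
  · intro ha
    have hp := (H g.hole).inner_p_pos
    rw [← (H g.hole).X_vertex g.σ g.τ]
    simp only [ha, Rect.side, Matrix.cons_val_zero] at h1
    simp only [Rect.X]
    rw [← sub_div, ← mul_div_assoc]
    exact div_nonneg h1 hp.le
  · intro ha
    have hq := (H g.hole).inner_q_pos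
    rw [← (H g.hole).Y_vertex g.σ g.τ]
    simp only [ha, Rect.side, Matrix.cons_val_one, Matrix.cons_val_zero] at h1
    simp only [Rect.Y]
    rw [← sub_div, ← mul_div_assoc]
    exact div_nonneg h1 hq.le

/-- Visibility limits the vertex of the guard, and the signs of the frame coordinates of the witness
limit its facing direction; together they determine `target`. -/
theorem exists_witness_target (hk : 1 ≤ k)
    (hH : ∀ i < k, ChainStep (interior (axisRect lo hi)) H i) (a : Option (Fin k × Fin 3)) :
    ∃ w ∈ region lo hi (fun i : Fin k => H i), ∀ g : VertexGuard k,
      g.Sees lo hi (fun i : Fin k => H i) w → g.target = a := by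
  have axis_cases : ∀ j : Fin 2, j = 0 ∨ j = 1 := by decide
  have neg_ne : ∀ u : ℤˣ, u ≠ -u := by decide
  have ne_one : (-1 : ℤˣ) ≠ 1 := by decide
  rcases a with _ | ⟨i, s⟩
  · obtain ⟨w, hw, hX, hY⟩ := exists_top_witness hH (i := k - 1) (by omega)
    refine ⟨w, hw.mem_region, fun g hg => ?_⟩
    obtain ⟨c0, c1⟩ := hg.coord
    obtain ⟨hhole, hτ⟩ := hw.of_visible g.hole g.σ g.τ hg.2
    rw [hhole, hτ] at c1
    rw [hhole] at c0
    have n1 : ¬((g.axis = 0 ∧ g.sgn = g.σ) ∨ (g.axis = 1 ∧ g.sgn = -g.τ)) := by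
      rintro (⟨h0, h1⟩ | ⟨h0, h1⟩)
      · exact neg_ne _ (h1.symm.trans (unit_eq_neg_of_mul_nonneg (c0 h0) hX))
      · have := unit_eq_one_of_mul_nonneg (c1 h0) (by push_cast; linarith)
        rw [h1, hτ] at this
        exact ne_one this
    rw [VertexGuard.target, if_neg n1, if_neg (by rw [hτ]; exact ne_one.symm),
      dif_neg (by omega)]
  · fin_cases s
    · obtain ⟨w, hw, hX, hY⟩ := exists_left_witness hH i.2
      refine ⟨w, hw.mem_region, fun g hg => ?_⟩
      obtain ⟨c0, c1⟩ := hg.coord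
      obtain ⟨hσ, hhole | ⟨hhole, hτ⟩⟩ := hw.of_visible g.hole g.σ g.τ hg.2
      · rw [hhole] at c0 c1
        have n1 : (g.axis = 0 ∧ g.sgn = g.σ) ∨ (g.axis = 1 ∧ g.sgn = -g.τ) := by
          rcases axis_cases g.axis with h0 | h0
          · left
            refine ⟨h0, ?_⟩
            have := c0 h0
            rw [hσ] at this ⊢
            exact unit_eq_neg_one_of_mul_nonneg this (by push_cast; linarith)
          · exact Or.inr ⟨h0, unit_eq_neg_of_mul_nonneg (c1 h0) hY⟩
        rw [VertexGuard.target, if_pos n1, if_pos hσ, Fin.ext hhole]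
        rfl
      -- The guard stands at the top left vertex of the previous hole. The witness is in the strip
      -- above that hole, so the guard faces inward along `p` or outward along `q`.
      · obtain ⟨hX', hY'⟩ := hw.above g.hole (by omega)
        have n1 : ¬((g.axis = 0 ∧ g.sgn = g.σ) ∨ (g.axis = 1 ∧ g.sgn = -g.τ)) := by
          rintro (⟨h0, h1⟩ | ⟨h0, h1⟩)
          · exact neg_ne _ (h1.symm.trans (unit_eq_neg_of_mul_nonneg (c0 h0) hX'))
          · have := c1 h0
            rw [h1, hτ] at this
            push_cast at this
            linarith
        rw [VertexGuard.target, if_neg n1, if_neg (by rw [hτ]; exact ne_one.symm),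
          dif_pos (by omega), if_pos hσ]
        simp only [hhole]
        rfl
    · obtain ⟨w, hw, hX, hY⟩ := exists_right_witness hH i.2
      refine ⟨w, hw.mem_region, fun g hg => ?_⟩
      obtain ⟨c0, c1⟩ := hg.coord
      obtain ⟨hhole, hσ⟩ := hw.of_visible g.hole g.σ g.τ hg.2
      rw [hhole] at c0 c1
      have n1 : (g.axis = 0 ∧ g.sgn = g.σ) ∨ (g.axis = 1 ∧ g.sgn = -g.τ) := by
        rcases axis_cases g.axis with h0 | h0
        · left
          refine ⟨h0, ?_⟩
          have := c0 h0
          rw [hσ] at this ⊢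
          exact unit_eq_one_of_mul_nonneg this (by push_cast; linarith)
        · exact Or.inr ⟨h0, unit_eq_neg_of_mul_nonneg (c1 h0) hY⟩
      rw [VertexGuard.target, if_pos n1, if_neg (by rw [hσ]; exact ne_one.symm), Fin.ext hhole]
      rfl
    · obtain ⟨w, hw, hX, hY⟩ := exists_bottom_witness hH i.2
      refine ⟨w, hw.mem_region, fun g hg => ?_⟩
      obtain ⟨c0, c1⟩ := hg.coord
      rcases hw.of_visible g.hole g.σ g.τ hg.2 with ⟨hhole, hτ⟩ | ⟨hhole, hτ, hσ⟩
      · rw [hhole] at c0 c1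
        have n1 : ¬((g.axis = 0 ∧ g.sgn = g.σ) ∨ (g.axis = 1 ∧ g.sgn = -g.τ)) := by
          rintro (⟨h0, h1⟩ | ⟨h0, h1⟩)
          · exact neg_ne _ (h1.symm.trans (unit_eq_neg_of_mul_nonneg (c0 h0) hX))
          · have := c1 h0
            rw [h1, hτ] at this
            push_cast at this
            linarith
        rw [VertexGuard.target, if_neg n1, if_pos hτ, Fin.ext hhole]
        rfl
      · obtain ⟨hX', hY'⟩ := hw.above g.hole (by omega)
        have n1 : ¬((g.axis = 0 ∧ g.sgn = g.σ) ∨ (g.axis = 1 ∧ g.sgn = -g.τ)) := by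
          rintro (⟨h0, h1⟩ | ⟨h0, h1⟩)
          · exact neg_ne _ (h1.symm.trans (unit_eq_neg_of_mul_nonneg (c0 h0) hX'))
          · have := c1 h0
            rw [h1, hτ] at this
            push_cast at this
            linarith
        rw [VertexGuard.target, if_neg n1, if_neg (by rw [hτ]; exact ne_one.symm),
          dif_pos (by omega), if_neg (by rw [hσ]; exact ne_one.symm)]
        simp only [hhole]
        rfl

theorem card_le_of_chain (hk : 1 ≤ k)
    (hH : ∀ i < k, ChainStep (interior (axisRect lo hi)) H i) {G : Finset (VertexGuard k)}
    (hG : IsGuarding lo hi (fun i : Fin k => H i) G) : 3 * k + 1 ≤ G.card := by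
  choose w hw hwt using exists_witness_target hk hH
  choose g hgG hg using fun a => hG (w a) (hw a)
  -- A guard chosen for a witness recovers its index as its `target`.
  have hinj : Function.Injective g := by
    intro a b hab
    rw [← hwt a (g a) (hg a), hab, hwt b (g b) (hg b)]
  calc 3 * k + 1 = (Finset.univ : Finset (Option (Fin k × Fin 3))).card := by
        simp [Fintype.card_option, mul_comm]
    _ ≤ G.card := Finset.card_le_card_of_injOn g (fun a _ => hgG a) hinj.injOn

end Chain

/-! ### The first hole and the conclusion. -/

/-- The square with center `0` and sides of length `2`. -/
def unitSquare : Rect where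
  center := 0
  p := !₂[1, 0]
  q := !₂[0, 1]
  p_ne_zero h := by simpa using congrArg (fun x : Plane => x 0) h
  q_ne_zero h := by simpa using congrArg (fun x : Plane => x 1) h
  orthogonal := by simp [PiLp.inner_apply]

theorem unitSquare_subset :
    unitSquare.carrier ⊆ interior (axisRect (!₂[-2, -2]) (!₂[2, 2])) := by
  have ho : IsOpen (⋂ i : Fin 2, {x : Plane | -2 < x i ∧ x i < 2}) :=
    isOpen_iInter_of_finite fun i =>
      have hc : Continuous fun x : Plane => x i := by fun_prop
      (isOpen_lt continuous_const hc).inter (isOpen_lt hc continuous_const)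
  refine Set.Subset.trans ?_ (interior_maximal ?_ ho)
  · rintro x ⟨s, t, hs, ht, rfl⟩
    rw [abs_le] at hs ht
    refine Set.mem_iInter.2 fun i => ?_
    fin_cases i <;> simp [unitSquare] <;> constructor <;> linarith
  · intro x hx i
    have := Set.mem_iInter.1 hx i
    fin_cases i <;> exact ⟨this.1.le, this.2.le⟩

theorem mainTheorem3 (k : ℕ) (hk : 1 ≤ k) :
    ∃ (lo hi : Plane) (H : Fin k → Rect), IsRectWithHoles lo hi H ∧
      (∃ G : Finset (VertexGuard k), IsGuarding lo hi H G) ∧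
      ∀ G : Finset (VertexGuard k), IsGuarding lo hi H G → 3 * k + 1 ≤ G.card := by
  obtain ⟨H, hH⟩ := exists_chain isOpen_interior unitSquare_subset k
  have hH' : ∀ i < k, ChainStep (interior (axisRect (!₂[-2, -2]) (!₂[2, 2]))) H i :=
    fun i hi => hH i hi.le
  refine ⟨!₂[-2, -2], !₂[2, 2], fun i => H i, isRectWithHoles_of_chain (fun i => ?_) hH',
    exists_isGuarding hk hH', fun G hG => card_le_of_chain hk hH' hG⟩
  fin_cases i <;> simp
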